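/- Let $n\in\mathbb N$ and let $\Delta=\operatorname{conv}\{v_0,v_1,\dots,v_n\}\subseteq\mathbb R^n$ be a full-dimensional simplex (i.e. $v_0,\dots,v_n$ are affinely independent), equipped with the Lebesgue measure. For a polynomial $f\in\mathbb R[x_1,\dots,x_n]$ and $r\in\mathbb N$ let $$f_{\min}=\min_{x\in\Delta}f(x),\qquad f^{(r)}=\inf\Big\{\int_\Delta f(x)q(x)\,dx \;:\; q\in\Sigma_r,\ \int_\Delta q(x)\,dx=1\Big\},\qquad E^{(r)}_{\Delta}(f)=f^{(r)}-f_{\min},$$ where $\Sigma_r$ is the set of sums of squares of real polynomials in $n$ variables of total degree at most $2r$, and let $$\beta_{\Delta,f}=\max_{x\in\Delta}\|\nabla f(x)\|,\qquad \gamma_{\Delta,f}=\tfrac12\max_{x\in\Delta}\|\nabla^2 f(x)\|$$ (Euclidean norm and operator norm, respectively). Then $E^{(r)}_{\Delta}(f)=O(1/r^2)$ in the following sense: for every such simplex $\Delta$ there is a function $c_\Delta:\mathbb R^2\to(0,\infty)$, depending only on $\Delta$, such that for every polynomial $f$ and every integer $r\ge 1$, $$E^{(r)}_{\Delta}(f)\le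 \frac{c_\Delta(\beta_{\Delta,f},\gamma_{\Delta,f})}{r^2}.$$ -/

import Mathlib

open MeasureTheory

noncomputable section

/-- The function on `ℝⁿ` (with its Euclidean norm) defined by an `n`-variate real polynomial. -/
def polyFun {n : ℕ} (f : MvPolynomial (Fin n) ℝ) (x : EuclideanSpace ℝ (Fin n)) : ℝ :=
  MvPolynomial.eval (fun i => x i) f

/-- `Σ_r`: the sums of squares of polynomials, of total degree at most `2 * r`. -/
def sosPolys (n r : ℕ) : Set (MvPolynomial (Fin n) ℝ) :=
  {q | IsSumSq q ∧ q.totalDegree ≤ 2 * r}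

/-- `f_{min,K}`: the minimum of `f` on `K` (attained when `K` is compact and nonempty). -/
def polyMin {n : ℕ} (K : Set (EuclideanSpace ℝ (Fin n))) (f : MvPolynomial (Fin n) ℝ) : ℝ :=
  sInf (polyFun f '' K)

/-- `f^{(r)}_{K,μ}`: the infimum of `∫_K f q dμ` over `q ∈ Σ_r` with `∫_K q dμ = 1`. -/
def lasserreUpperBound {n : ℕ} (K : Set (EuclideanSpace ℝ (Fin n)))
    (μ : Measure (EuclideanSpace ℝ (Fin n))) (f : MvPolynomial (Fin n) ℝ) (r : ℕ) : ℝ :=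
  sInf {t : ℝ | ∃ q ∈ sosPolys n r,
    ∫ x in K, polyFun q x ∂μ = 1 ∧ t = ∫ x in K, polyFun f x * polyFun q x ∂μ}

/-- `E^{(r)}_{K,μ}(f) = f^{(r)}_{K,μ} - f_{min,K}`. -/
def lasserreError {n : ℕ} (K : Set (EuclideanSpace ℝ (Fin n)))
    (μ : Measure (EuclideanSpace ℝ (Fin n))) (f : MvPolynomial (Fin n) ℝ) (r : ℕ) : ℝ :=
  lasserreUpperBound K μ f r - polyMin K f

/-- `β_{K,f}`: the maximum over `K` of the Euclidean norm of the gradient of `f`. -/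
def gradConst {n : ℕ} (K : Set (EuclideanSpace ℝ (Fin n))) (f : MvPolynomial (Fin n) ℝ) : ℝ :=
  sSup ((fun x => ‖gradient (polyFun f) x‖) '' K)

/-- `γ_{K,f}`: half the maximum over `K` of the operator norm of the Hessian of `f`
(the second derivative, viewed as a bounded bilinear form). -/
def hessConst {n : ℕ} (K : Set (EuclideanSpace ℝ (Fin n))) (f : MvPolynomial (Fin n) ℝ) : ℝ :=
  (1 / 2) * sSup ((fun x => ‖fderiv ℝ (fderiv ℝ (polyFun f)) x‖) '' K)

/-- The convex hull of the vertices of a simplex. As `Affine.Simplex` asks for affinely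
independent vertices, `n + 1` of them in `ℝⁿ` span a full-dimensional simplex. -/
def simplexSet {n : ℕ} (s : Affine.Simplex ℝ (EuclideanSpace ℝ (Fin n)) n) :
    Set (EuclideanSpace ℝ (Fin n)) :=
  convexHull ℝ (Set.range s.points)

end

/-! Let `a` minimise `f` on the simplex. Since f^(r) is an infimum, it suffices to exhibit one
square `P ^ 2` with `P` of degree at most `r`, concentrated near `a`, against which `f - f a`
averages to O(1/r²).

Some vertex has barycentric weight at least 1/(n+1) in `a`. In the edge coordinates at that vertex
the simplex becomes {y ≥ 0, ∑ y ≤ 1} inside the unit cube, and `a` stays away from the facet ∑ y =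
1. Taylor's formula bounds `f x - f a` by a linear term plus a multiple of ‖x - a‖². If a_j > 0,
both directions along edge j are feasible, so minimality kills that linear term; if a_j = 0, a
multiple of y_j remains (`polyFun_sub_le`). Hence second moments of order 1/r² are needed in every
coordinate, and also a first moment of order 1/r² wherever a_j = 0.

Powers of the Fejér kernel provide such densities on [0,1]: in the variable sin² φ the kernel has
width 1/N² at the endpoint 0, which gives the first moment; evaluated at (x - a)² it has width 1/N,
which gives the second (`exists_univariate_density`). Their product is handled on the cube, where
integrals factor, and Chebyshev's inequality shows that at least half of its mass lies in the
simplex (`exists_prodDensity`). -/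

/-! ### The Fejér kernel as a concentrated polynomial. -/

theorem abs_sin_nat_mul_le (N : ℕ) (φ : ℝ) : |Real.sin (N * φ)| ≤ N * |Real.sin φ| := by
  induction N with
  | zero => simp
  | succ k ih =>
    push_cast
    rw [add_mul, one_mul, Real.sin_add]
    calc |Real.sin (k * φ) * Real.cos φ + Real.cos (k * φ) * Real.sin φ|
        ≤ |Real.sin (k * φ)| * |Real.cos φ| + |Real.cos (k * φ)| * |Real.sin φ| := by
          rw [← abs_mul, ← abs_mul]; exact abs_add_le _ _
      _ ≤ |Real.sin (k * φ)| * 1 + 1 * |Real.sin φ| := by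
          gcongr
          · exact Real.abs_cos_le_one _
          · exact Real.abs_cos_le_one _
      _ ≤ (k + 1) * |Real.sin φ| := by linarith

/-- The Fejér kernel, as a polynomial in `sin² φ`. -/
theorem exists_fejer_polynomial (N : ℕ) : ∃ F : Polynomial ℝ, F.natDegree ≤ N ∧
    ∀ φ : ℝ, Real.sin φ ^ 2 * F.eval (Real.sin φ ^ 2) = Real.sin (N * φ) ^ 2 := by
  -- At X = sin² φ the inner argument is cos 2φ, so `G` takes the value (1 - cos 2Nφ)/2 = sin² Nφ;
  -- it vanishes at 0, hence is divisible by X.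
  set G : Polynomial ℝ := Polynomial.C (1 / 2) *
    (1 - (Polynomial.Chebyshev.T ℝ N).comp (1 - Polynomial.C 2 * Polynomial.X)) with hG
  have hev : ∀ φ : ℝ, G.eval (Real.sin φ ^ 2) = Real.sin (N * φ) ^ 2 := by
    intro φ
    have h1 : (1 : ℝ) - 2 * Real.sin φ ^ 2 = Real.cos (2 * φ) := by
      rw [Real.cos_two_mul, Real.cos_sq']; ring
    simp only [hG, Polynomial.eval_mul, Polynomial.eval_C, Polynomial.eval_sub, Polynomial.eval_one,
      Polynomial.eval_comp, Polynomial.eval_X, h1, Polynomial.Chebyshev.T_real_cos]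
    have h2 : ((N : ℤ) : ℝ) * (2 * φ) = 2 * (N * φ) := by push_cast; ring
    rw [h2, Real.cos_two_mul, Real.cos_sq']; ring
  have h0 : G.eval 0 = 0 := by simpa using hev 0
  obtain ⟨F, hF⟩ : Polynomial.X ∣ G := by
    rw [Polynomial.X_dvd_iff, Polynomial.coeff_zero_eq_eval_zero, h0]
  refine ⟨F, ?_, fun φ => ?_⟩
  · have hd : G.natDegree ≤ N := by
      rw [hG]
      refine Polynomial.natDegree_C_mul_le _ _ |>.trans ?_
      refine (Polynomial.natDegree_sub_le _ _).trans (max_le (by simp) ?_)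
      refine Polynomial.natDegree_comp_le.trans ?_
      rw [Polynomial.Chebyshev.natDegree_T]
      have : (1 - Polynomial.C 2 * Polynomial.X : Polynomial ℝ).natDegree ≤ 1 := by
        compute_degree
      simpa using Nat.mul_le_mul_left N this
    by_cases hF0 : F = 0
    · simp [hF0]
    · rw [hF, Polynomial.natDegree_X_mul hF0] at hd
      omega
  · rw [← hev, hF]; simp

/-- For x = sin² φ the Fejér polynomial is sin² Nφ / sin² φ. The upper bounds come from |sin Nφ| ≤ N
|sin φ| and |sin Nφ| ≤ 1, the lower bound from Jordan's inequality. The point x = 0, where the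
quotient is undefined, follows by taking closures. -/
theorem exists_concentrated_polynomial (N : ℕ) (hN : 1 ≤ N) : ∃ F : Polynomial ℝ,
    F.natDegree ≤ N ∧ (∀ x ∈ Set.Icc (0 : ℝ) 1, 0 ≤ F.eval x ∧ F.eval x ≤ N ^ 2 ∧
      x * F.eval x ≤ 1) ∧
    ∀ x ∈ Set.Icc (0 : ℝ) ((1 / (N : ℝ)) ^ 2), (N : ℝ) ^ 2 / 4 ≤ F.eval x := by
  obtain ⟨F, hd, hF⟩ := exists_fejer_polynomial N
  have hN' : (1 : ℝ) ≤ N := by exact_mod_cast hN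
  have key : ∀ x ∈ Set.Ioc (0 : ℝ) 1, ∃ φ : ℝ, 0 < φ ∧ φ ≤ Real.pi / 2 ∧ x = Real.sin φ ^ 2 := by
    intro x hx
    have hs : 0 < √x := Real.sqrt_pos.2 hx.1
    refine ⟨Real.arcsin √x, Real.arcsin_pos.2 hs, Real.arcsin_le_pi_div_two _, ?_⟩
    rw [Real.sin_arcsin (by linarith) (Real.sqrt_le_one.2 hx.2), Real.sq_sqrt hx.1.le]
  refine ⟨F, hd, fun x hx => ?_, fun x hx => ?_⟩
  · have hcl : IsClosed {x : ℝ | 0 ≤ F.eval x ∧ F.eval x ≤ N ^ 2 ∧ x * F.eval x ≤ 1} := by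
      refine (isClosed_le continuous_const F.continuous).inter
        ((isClosed_le F.continuous continuous_const).inter
          (isClosed_le (continuous_id.mul F.continuous) continuous_const))
    have hsub : Set.Ioc (0 : ℝ) 1 ⊆
        {x : ℝ | 0 ≤ F.eval x ∧ F.eval x ≤ N ^ 2 ∧ x * F.eval x ≤ 1} := by
      intro y hy
      obtain ⟨φ, h1, h2, rfl⟩ := key y hy
      have := hF φ
      have hb : Real.sin (N * φ) ^ 2 ≤ N ^ 2 * Real.sin φ ^ 2 := by
        have := abs_sin_nat_mul_le N φ
        rw [← sq_abs, ← sq_abs (Real.sin φ), ← mul_pow]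
        gcongr
      refine ⟨?_, ?_, ?_⟩
      · by_contra! h
        nlinarith [sq_nonneg (Real.sin (N * φ)), mul_neg_of_pos_of_neg hy.1 h]
      · refine le_of_mul_le_mul_left ?_ hy.1
        rw [this]; linarith
      · rw [this]; exact Real.sin_sq_le_one _
    have := hcl.closure_subset_iff.2 hsub
    rw [closure_Ioc (by norm_num)] at this
    exact this hx
  · have hpos : (0 : ℝ) < (1 / (N : ℝ)) ^ 2 := by positivity
    have hle : (1 / (N : ℝ)) ≤ 1 := by rw [div_le_one (by linarith)]; exact hN'
    have hsub : Set.Ioc (0 : ℝ) ((1 / (N : ℝ)) ^ 2) ⊆ {x : ℝ | (N : ℝ) ^ 2 / 4 ≤ F.eval x} := by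
      intro y hy
      obtain ⟨φ, h1, h2, rfl⟩ := key y ⟨hy.1, hy.2.trans (pow_le_one₀ (by positivity) hle)⟩
      have h0 : 0 ≤ Real.sin φ := Real.sin_nonneg_of_nonneg_of_le_pi h1.le (by linarith [Real.pi_pos])
      have hs : Real.sin φ ≤ 1 / N := by
        exact (pow_le_pow_iff_left₀ h0 (by positivity) two_ne_zero).1 hy.2
      have hj := Real.mul_le_sin h1.le h2
      -- Jordan's inequality for φ keeps Nφ within [0, π/2], so that it can be applied again to Nφ.
      have hφ : N * φ ≤ Real.pi / 2 := by
        have : 2 / Real.pi * φ ≤ 1 / N := hj.trans hs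
        rw [div_mul_eq_mul_div, div_le_div_iff₀ Real.pi_pos (by linarith)] at this
        linarith
      have hj2 := Real.mul_le_sin (by positivity : 0 ≤ N * φ) hφ
      have hpi : (1 : ℝ) / 2 ≤ 2 / Real.pi := by
        rw [div_le_div_iff₀ two_pos Real.pi_pos]; linarith [Real.pi_le_four]
      have hj3 : N * φ / 2 ≤ Real.sin (N * φ) := by
        refine le_trans ?_ hj2
        have := mul_le_mul_of_nonneg_right hpi (by positivity : 0 ≤ N * φ)
        linarith
      have hsl : Real.sin φ ≤ φ := Real.sin_le h1.le
      refine le_of_mul_le_mul_left ?_ hy.1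
      rw [hF]
      calc Real.sin φ ^ 2 * ((N : ℝ) ^ 2 / 4) ≤ φ ^ 2 * ((N : ℝ) ^ 2 / 4) := by gcongr
        _ = (N * φ / 2) ^ 2 := by ring
        _ ≤ _ := by gcongr
    have hcl : IsClosed {x : ℝ | (N : ℝ) ^ 2 / 4 ≤ F.eval x} :=
      isClosed_le continuous_const F.continuous
    have := hcl.closure_subset_iff.2 hsub
    rw [closure_Ioc hpos.ne] at this
    exact this hx

/-! ### Univariate densities on [0,1]. -/

/-- Split at 1/M and put E = M^(w+2+k). Below 1/M, (Mx)^w g ≤ E; above it, (Mx)^w g ≤ E/(Mx)², the 2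
in the exponent making this tail integrable. Each piece is at most E/M, while g has mass at least
E/(256 M). The 256 = 4⁴ comes from the fourth power of the bound N²/4 for the Fejér kernel; `k` is
unused decay. -/
theorem integral_pow_mul_le_of_concentrated {g : ℝ → ℝ} (hg : Continuous g) {M : ℝ} (hM : 1 ≤ M)
    (w k : ℕ) (h0 : ∀ x ∈ Set.Icc (0 : ℝ) 1, 0 ≤ g x ∧ g x ≤ M ^ (w + 2 + k) ∧
      x ^ (w + 2 + k) * g x ≤ 1)
    (h1 : ∀ x ∈ Set.Icc (0 : ℝ) (1 / M), M ^ (w + 2 + k) / 256 ≤ g x) :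
    M ^ w * ∫ x in (0 : ℝ)..1, x ^ w * g x ≤ 512 * ∫ x in (0 : ℝ)..1, g x := by
  have hM0 : 0 < M := by linarith
  have hle : 1 / M ≤ 1 := by rw [div_le_one hM0]; exact hM
  have hpos : 0 < 1 / M := by positivity
  have hc : Continuous fun x => M ^ w * (x ^ w * g x) := by fun_prop
  set E := M ^ (w + 2 + k) with hE
  have hE0 : 0 < E := by positivity
  have i1 : ∫ x in (0 : ℝ)..(1 / M), M ^ w * (x ^ w * g x) ≤ E / M := by
    calc _ ≤ ∫ x in (0 : ℝ)..(1 / M), E := by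
          refine intervalIntegral.integral_mono_on hpos.le (hc.intervalIntegrable _ _) (by simp) ?_
          intro x hx
          obtain ⟨a, b, -⟩ := h0 x ⟨hx.1, hx.2.trans hle⟩
          have : (M * x) ^ w ≤ 1 := pow_le_one₀ (mul_nonneg hM0.le hx.1) (by
            have := hx.2; rw [le_div_iff₀ hM0] at this; linarith)
          calc _ = (M * x) ^ w * g x := by ring
            _ ≤ 1 * g x := by gcongr
            _ ≤ E := by linarith
      _ = E / M := by simp; ring
  have i2 : ∫ x in (1 / M)..1, M ^ w * (x ^ w * g x) ≤ E / M := by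
    have hni : (0 : ℝ) ∉ Set.uIcc (1 / M) 1 := by
      rw [Set.uIcc_of_le hle]; intro h; linarith [h.1]
    calc _ ≤ ∫ x in (1 / M)..1, E / M ^ 2 * x ^ (-2 : ℤ) := by
          refine intervalIntegral.integral_mono_on hle (hc.intervalIntegrable _ _)
            ((intervalIntegral.intervalIntegrable_zpow (Or.inr hni)).const_mul _) ?_
          intro x hx
          have hx0 : 0 < x := hpos.trans_le hx.1
          obtain ⟨a, b, c⟩ := h0 x ⟨hx0.le, hx.2⟩
          have hMx : 1 ≤ M * x := by
            have := hx.1; rw [div_le_iff₀ hM0] at this; linarith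
          have : (M * x) ^ (w + 2) * g x ≤ E := by
            calc _ ≤ (M * x) ^ (w + 2 + k) * g x := by
                  exact mul_le_mul_of_nonneg_right (pow_le_pow_right₀ hMx (by omega)) a
              _ = E * (x ^ (w + 2 + k) * g x) := by rw [hE]; ring
              _ ≤ E * 1 := by gcongr
              _ = E := mul_one _
          rw [zpow_neg, ← div_eq_mul_inv, div_div, le_div_iff₀ (by positivity)]
          calc _ = (M * x) ^ (w + 2) * g x := by
                rw [show ((2 : ℤ)) = ((2 : ℕ) : ℤ) by rfl, zpow_natCast]; ring
            _ ≤ E := this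
      _ = E / M ^ 2 * (M - 1) := by
          rw [intervalIntegral.integral_const_mul, integral_zpow (Or.inr ⟨by norm_num, hni⟩)]
          congr 1
          norm_num
          ring
      _ ≤ E / M ^ 2 * M := by gcongr; linarith
      _ = E / M := by field_simp
  have i3 : E / M / 256 ≤ ∫ x in (0 : ℝ)..1, g x := by
    calc E / M / 256 = ∫ x in (0 : ℝ)..(1 / M), E / 256 := by simp; ring
      _ ≤ ∫ x in (0 : ℝ)..(1 / M), g x :=
          intervalIntegral.integral_mono_on hpos.le (by simp) (hg.intervalIntegrable _ _) h1
      _ ≤ ∫ x in (0 : ℝ)..1, g x := by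
          refine intervalIntegral.integral_mono_interval le_rfl hpos.le hle ?_
            (hg.intervalIntegrable _ _)
          refine (ae_restrict_iff' measurableSet_Ioc).2 (Filter.Eventually.of_forall ?_)
          intro x hx
          exact (h0 x ⟨hx.1.le, hx.2⟩).1
  rw [← intervalIntegral.integral_const_mul,
    ← intervalIntegral.integral_add_adjacent_intervals (hc.intervalIntegrable 0 (1 / M))
      (hc.intervalIntegrable _ 1)]
  linarith

theorem Polynomial.exists_normalized {p : Polynomial ℝ} {d : ℕ} (hd : p.natDegree ≤ d)
    (hp : 0 < ∫ x in (0 : ℝ)..1, p.eval x ^ 2) : ∃ q : Polynomial ℝ, q.natDegree ≤ d ∧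
      ∀ h : ℝ → ℝ, ∫ x in (0 : ℝ)..1, h x * q.eval x ^ 2 =
        (∫ x in (0 : ℝ)..1, h x * p.eval x ^ 2) / ∫ x in (0 : ℝ)..1, p.eval x ^ 2 := by
  set I := ∫ x in (0 : ℝ)..1, p.eval x ^ 2
  refine ⟨Polynomial.C (√I)⁻¹ * p, (Polynomial.natDegree_C_mul_le _ _).trans hd, fun h => ?_⟩
  rw [← intervalIntegral.integral_div]
  congr 1
  ext x
  rw [Polynomial.eval_mul, Polynomial.eval_C, mul_pow, inv_pow, Real.sq_sqrt hp.le]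
  field_simp

theorem integral_even_interval {g : ℝ → ℝ} (he : ∀ x, g (-x) = g x) (b : ℝ) :
    ∫ x in (-b)..0, g x = ∫ x in (0 : ℝ)..b, g x := by
  have := intervalIntegral.integral_comp_neg (f := g) (a := 0) (b := b)
  simp only [he, neg_zero] at this
  exact this.symm

/-- The density is a normalised F⁴, concentrated at scale 1/M with M = N², so already its first
moment is of order 1/N². -/
theorem exists_density_at_endpoint {N : ℕ} (hN : 1 ≤ N) : ∃ p : Polynomial ℝ,
    p.natDegree ≤ 4 * N ∧ ∫ x in (0 : ℝ)..1, p.eval x ^ 2 = 1 ∧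
      ∫ x in (0 : ℝ)..1, x * p.eval x ^ 2 ≤ 2048 / (N : ℝ) ^ 2 := by
  obtain ⟨F, hd, hF, hF'⟩ := exists_concentrated_polynomial N hN
  have hN' : (1 : ℝ) ≤ N := by exact_mod_cast hN
  have hg : Continuous fun x => (F ^ 2).eval x ^ 2 := (F ^ 2).continuous.pow 2
  have hlow : ∀ x ∈ Set.Icc (0 : ℝ) ((1 / (N : ℝ)) ^ 2), ((N : ℝ) ^ 2) ^ 4 / 256 ≤
      (F ^ 2).eval x ^ 2 := by
    intro x hx
    calc ((N : ℝ) ^ 2) ^ 4 / 256 = ((N : ℝ) ^ 2 / 4) ^ 4 := by ring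
      _ ≤ (F.eval x) ^ 4 := by gcongr; exact hF' x hx
      _ = _ := by rw [Polynomial.eval_pow]; ring
  have key := integral_pow_mul_le_of_concentrated hg (M := (N : ℝ) ^ 2) (one_le_pow₀ hN') 1 1
    (fun x hx => ?_) (fun x hx => hlow x (by simpa using hx))
  · have hpos : 0 < ∫ x in (0 : ℝ)..1, (F ^ 2).eval x ^ 2 := by
      refine intervalIntegral.integral_pos one_pos hg.continuousOn (fun x _ => by positivity)
        ⟨0, by simp, ?_⟩
      refine lt_of_lt_of_le ?_ (hlow 0 ⟨le_rfl, by positivity⟩)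
      positivity
    obtain ⟨q, hq, hqi⟩ := Polynomial.exists_normalized (p := F ^ 2) (d := 4 * N)
      (Polynomial.natDegree_pow_le.trans (by omega)) hpos
    refine ⟨q, hq, ?_, ?_⟩
    · have := hqi fun _ => 1
      simp only [one_mul] at this
      rw [this, div_self hpos.ne']
    · rw [hqi fun x => x, div_le_div_iff₀ hpos (by positivity)]
      simp only [pow_one] at key
      linarith
  · obtain ⟨a, b, c⟩ := hF x hx
    have e : (F ^ 2).eval x ^ 2 = F.eval x ^ 4 := by rw [Polynomial.eval_pow]; ring
    rw [e]
    refine ⟨by positivity, by gcongr, ?_⟩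
    calc x ^ (1 + 2 + 1) * F.eval x ^ 4 = (x * F.eval x) ^ 4 := by ring
      _ ≤ 1 := pow_le_one₀ (mul_nonneg hx.1 a) c

/-- The density is F((x - a)²)⁴, normalised. After translation to [-a, 1 - a], the numerator is at
most the even integral over [-1,1]. The interval contains [0,1/2] or [-1/2,0], and either half holds
at least half of the mass of [0,1]. -/
theorem exists_density_at_point {N : ℕ} (hN : 64 ≤ N) {a : ℝ} (ha : a ∈ Set.Icc (0 : ℝ) 1) :
    ∃ p : Polynomial ℝ, p.natDegree ≤ 4 * N ∧ ∫ x in (0 : ℝ)..1, p.eval x ^ 2 = 1 ∧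
      ∫ x in (0 : ℝ)..1, (x - a) ^ 2 * p.eval x ^ 2 ≤ 2048 / (N : ℝ) ^ 2 := by
  obtain ⟨F, hd, hF, hF'⟩ := exists_concentrated_polynomial N (by omega)
  have hN64 : (64 : ℝ) ≤ N := by exact_mod_cast hN
  have hN' : (1 : ℝ) ≤ N := by linarith
  set g : ℝ → ℝ := fun t => F.eval (t ^ 2) ^ 4 with hgdef
  have hg : Continuous g := (F.continuous.comp (continuous_pow 2)).pow 4
  have hgt : Continuous fun t => t ^ 2 * g t := (continuous_pow 2).mul hg
  have hg0 : ∀ t, 0 ≤ g t := fun t => by simp only [hgdef]; positivity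
  have hsq : ∀ x ∈ Set.Icc (0 : ℝ) 1, x ^ 2 ∈ Set.Icc (0 : ℝ) 1 := fun x hx =>
    ⟨by positivity, pow_le_one₀ hx.1 hx.2⟩
  have hlow : ∀ x ∈ Set.Icc (0 : ℝ) (1 / (N : ℝ)), (N : ℝ) ^ (2 + 2 + 4) / 256 ≤ g x := by
    intro x hx
    calc (N : ℝ) ^ (2 + 2 + 4) / 256 = ((N : ℝ) ^ 2 / 4) ^ 4 := by ring
      _ ≤ (F.eval (x ^ 2)) ^ 4 := by
        gcongr
        exact hF' _ ⟨by positivity, pow_le_pow_left₀ hx.1 hx.2 2⟩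
  have key := integral_pow_mul_le_of_concentrated hg hN' 2 4 (fun x hx => by
    obtain ⟨a, b, c⟩ := hF _ (hsq x hx)
    refine ⟨hg0 x, ?_, ?_⟩
    · calc g x ≤ ((N : ℝ) ^ 2) ^ 4 := by simp only [hgdef]; gcongr
        _ = _ := by ring
    · calc x ^ (2 + 2 + 4) * g x = (x ^ 2 * F.eval (x ^ 2)) ^ 4 := by simp only [hgdef]; ring
        _ ≤ 1 := pow_le_one₀ (mul_nonneg (by positivity) a) c) hlow
  set I₀ := ∫ x in (0 : ℝ)..1, g x
  set I₂ := ∫ x in (0 : ℝ)..1, x ^ 2 * g x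
  have hI₀ : 0 < I₀ := by
    refine intervalIntegral.integral_pos one_pos hg.continuousOn (fun x _ => hg0 x)
      ⟨0, by simp, ?_⟩
    refine lt_of_lt_of_le ?_ (hlow 0 ⟨le_rfl, by positivity⟩)
    positivity
  have hmono : ∀ {h : ℝ → ℝ}, Continuous h → (∀ x, 0 ≤ h x) → ∀ {b c d e : ℝ}, b ≤ c → c ≤ d →
      d ≤ e → ∫ x in c..d, h x ≤ ∫ x in b..e, h x := by
    intro h hc h0 b c d e h1 h2 h3
    exact intervalIntegral.integral_mono_interval h1 h2 h3 (Filter.Eventually.of_forall h0)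
      (hc.intervalIntegrable _ _)
  have heven : ∀ x, g (-x) = g x := fun x => by simp [hgdef]
  have hI₂ : I₂ * (N : ℝ) ^ 2 ≤ 512 * I₀ := by linarith
  have hI₂0 : 0 ≤ I₂ := intervalIntegral.integral_nonneg zero_le_one
    fun x _ => mul_nonneg (by positivity) (hg0 x)
  have hup : ∫ t in (-a)..(1 - a), t ^ 2 * g t ≤ 2 * I₂ := by
    calc _ ≤ ∫ t in (-1 : ℝ)..1, t ^ 2 * g t :=
          hmono hgt (fun x => mul_nonneg (by positivity) (hg0 x)) (by linarith [ha.2])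
            (by linarith) (by linarith [ha.1])
      _ = 2 * I₂ := by
          rw [← intervalIntegral.integral_add_adjacent_intervals (hgt.intervalIntegrable (-1) 0)
            (hgt.intervalIntegrable 0 1),
            integral_even_interval (fun x => by rw [heven, neg_sq])]
          ring
  have hhalf : I₀ / 2 ≤ ∫ x in (0 : ℝ)..(1 / 2), g x := by
    have h1 : ∫ x in (1 / 2 : ℝ)..1, g x ≤ 4 * I₂ := by
      calc ∫ x in (1 / 2 : ℝ)..1, g x ≤ ∫ x in (1 / 2 : ℝ)..1, 4 * (x ^ 2 * g x) := by
            refine intervalIntegral.integral_mono_on (by norm_num) (hg.intervalIntegrable _ _)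
              ((hgt.const_mul 4).intervalIntegrable _ _) fun x hx => ?_
            nlinarith [hg0 x, hx.1, mul_nonneg (hg0 x) (by nlinarith [hx.1] : 0 ≤ 4 * x ^ 2 - 1)]
        _ = 4 * ∫ x in (1 / 2 : ℝ)..1, x ^ 2 * g x := intervalIntegral.integral_const_mul _ _
        _ ≤ 4 * I₂ := by
            gcongr
            exact hmono hgt (fun x => mul_nonneg (by positivity) (hg0 x)) (by norm_num)
              (by norm_num) le_rfl
    have h2 : I₀ = (∫ x in (0 : ℝ)..(1 / 2), g x) + ∫ x in (1 / 2 : ℝ)..1, g x :=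
      (intervalIntegral.integral_add_adjacent_intervals (hg.intervalIntegrable _ _)
        (hg.intervalIntegrable _ _)).symm
    -- Here N ≥ 64 enters, as 64² = 4096: the mass on [1/2,1] is then at most `I₀ / 2`.
    have h3 : 4096 * I₂ ≤ 512 * I₀ := by
      refine le_trans ?_ hI₂
      rw [mul_comm]
      gcongr
      nlinarith
    linarith
  have hdown : I₀ / 2 ≤ ∫ t in (-a)..(1 - a), g t := by
    refine hhalf.trans ?_
    rcases le_total a (1 / 2) with h | h
    · exact hmono hg hg0 (by linarith [ha.1]) (by norm_num) (by linarith)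
    · rw [← integral_even_interval heven]
      exact hmono hg hg0 (by linarith) (by norm_num) (by linarith [ha.2])
  set P : Polynomial ℝ := (F.comp ((Polynomial.X - Polynomial.C a) ^ 2)) ^ 2 with hP
  have hPe : ∀ x, P.eval x ^ 2 = g (x - a) := fun x => by
    simp only [hP, hgdef, Polynomial.eval_pow, Polynomial.eval_comp, Polynomial.eval_sub,
      Polynomial.eval_X, Polynomial.eval_C]
    ring
  have hPd : P.natDegree ≤ 4 * N := by
    refine Polynomial.natDegree_pow_le.trans ?_
    have h1 : ((Polynomial.X - Polynomial.C a : Polynomial ℝ) ^ 2).natDegree ≤ 2 := by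
      refine Polynomial.natDegree_pow_le.trans ?_
      rw [Polynomial.natDegree_X_sub_C]
    have h2 := Polynomial.natDegree_comp_le
      (p := F) (q := (Polynomial.X - Polynomial.C a : Polynomial ℝ) ^ 2)
    nlinarith [Nat.mul_le_mul hd h1]
  have hPi : ∫ x in (0 : ℝ)..1, P.eval x ^ 2 = ∫ t in (-a)..(1 - a), g t := by
    simp_rw [hPe]
    rw [intervalIntegral.integral_comp_sub_right (fun t => g t), zero_sub]
  have hPi2 : ∫ x in (0 : ℝ)..1, (x - a) ^ 2 * P.eval x ^ 2 =
      ∫ t in (-a)..(1 - a), t ^ 2 * g t := by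
    simp_rw [hPe]
    rw [intervalIntegral.integral_comp_sub_right (fun t => t ^ 2 * g t), zero_sub]
  have hpos : 0 < ∫ x in (0 : ℝ)..1, P.eval x ^ 2 := by rw [hPi]; linarith
  obtain ⟨q, hq, hqi⟩ := Polynomial.exists_normalized hPd hpos
  refine ⟨q, hq, ?_, ?_⟩
  · have := hqi fun _ => 1
    simp only [one_mul] at this
    rw [this, div_self hpos.ne']
  · rw [hqi fun x => (x - a) ^ 2, div_le_div_iff₀ hpos (by positivity), hPi, hPi2]
    calc _ ≤ 2 * I₂ * (N : ℝ) ^ 2 := by gcongr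
      _ ≤ 2048 * (I₀ / 2) := by linarith
      _ ≤ _ := by gcongr

theorem exists_univariate_density {N : ℕ} (hN : 64 ≤ N) {a : ℝ} (ha : a ∈ Set.Icc (0 : ℝ) 1) :
    ∃ p : Polynomial ℝ, p.natDegree ≤ 4 * N ∧ ∫ x in Set.Icc (0 : ℝ) 1, p.eval x ^ 2 = 1 ∧
      ∫ x in Set.Icc (0 : ℝ) 1, (x - a) ^ 2 * p.eval x ^ 2 ≤ 2048 / (N : ℝ) ^ 2 ∧
      (a = 0 → ∫ x in Set.Icc (0 : ℝ) 1, x * p.eval x ^ 2 ≤ 2048 / (N : ℝ) ^ 2) := by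
  simp only [integral_Icc_eq_integral_Ioc, ← intervalIntegral.integral_of_le zero_le_one]
  by_cases h : a = 0
  · obtain ⟨p, h1, h2, h3⟩ := exists_density_at_endpoint (N := N) (by omega)
    -- At a = 0 the second moment is dominated by the first, because x² ≤ x on [0,1].
    refine ⟨p, h1, h2, le_trans ?_ h3, fun _ => h3⟩
    refine intervalIntegral.integral_mono_on zero_le_one
      (Continuous.intervalIntegrable (by fun_prop) _ _)
      (Continuous.intervalIntegrable (by fun_prop) _ _) fun x hx => ?_
    rw [h, sub_zero]
    gcongr
    nlinarith [hx.1, hx.2]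
  · obtain ⟨p, h1, h2, h3⟩ := exists_density_at_point hN ha
    exact ⟨p, h1, h2, h3, fun h' => absurd h' h⟩

/-! ### Product densities on the corner simplex. -/

/-- The simplex `{y ≥ 0, ∑ y ≤ 1}`. -/
def cornerSimplex (n : ℕ) : Set (Fin n → ℝ) := {y | (∀ j, 0 ≤ y j) ∧ ∑ j, y j ≤ 1}

/-- The unit cube `[0, 1]ⁿ`. -/
def unitBox (n : ℕ) : Set (Fin n → ℝ) := Set.univ.pi fun _ => Set.Icc 0 1

/-- The product `∏ j, p j (y j) ^ 2`. -/
def prodDensity {n : ℕ} (p : Fin n → Polynomial ℝ) (y : Fin n → ℝ) : ℝ :=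
  ∏ j, (p j).eval (y j) ^ 2

theorem continuous_prodDensity {n : ℕ} (p : Fin n → Polynomial ℝ) :
    Continuous (prodDensity p) :=
  continuous_finsetProd _ fun j _ => ((p j).continuous.comp (continuous_apply j)).pow 2

theorem prodDensity_nonneg {n : ℕ} (p : Fin n → Polynomial ℝ) (y : Fin n → ℝ) :
    0 ≤ prodDensity p y :=
  Finset.prod_nonneg fun _ _ => sq_nonneg _

theorem cornerSimplex_subset_unitBox (n : ℕ) : cornerSimplex n ⊆ unitBox n := fun _ hy j _ =>
  ⟨hy.1 j, (Finset.single_le_sum (fun i _ => hy.1 i) (Finset.mem_univ j)).trans hy.2⟩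

theorem isClosed_cornerSimplex (n : ℕ) : IsClosed (cornerSimplex n) := by
  refine IsClosed.inter (s₁ := {y : Fin n → ℝ | ∀ j, 0 ≤ y j}) ?_
    (isClosed_le (f := fun y : Fin n → ℝ => ∑ j, y j) (by fun_prop) continuous_const)
  rw [Set.ofPred_forall]
  exact isClosed_iInter fun j => isClosed_le continuous_const (continuous_apply j)

theorem isCompact_unitBox (n : ℕ) : IsCompact (unitBox n) :=
  isCompact_univ_pi fun _ => isCompact_Icc

theorem isCompact_cornerSimplex (n : ℕ) : IsCompact (cornerSimplex n) :=
  (isCompact_unitBox n).of_isClosed_subset (isClosed_cornerSimplex n)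
    (cornerSimplex_subset_unitBox n)

theorem volume_cornerSimplex_pos (n : ℕ) : 0 < volume (cornerSimplex n) := by
  set U : Set (Fin n → ℝ) := Set.univ.pi fun _ => Set.Ioo 0 (1 / ((n : ℝ) + 1)) with hU
  have hUT : U ⊆ cornerSimplex n := by
    intro y hy
    refine ⟨fun j => (hy j trivial).1.le, ?_⟩
    calc ∑ j, y j ≤ ∑ _j : Fin n, 1 / ((n : ℝ) + 1) :=
          Finset.sum_le_sum fun j _ => (hy j trivial).2.le
      _ = n / (n + 1) := by simp; ring
      _ ≤ 1 := by rw [div_le_one (by positivity)]; linarith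
  refine lt_of_lt_of_le (IsOpen.measure_pos _ ?_ ?_) (measure_mono hUT)
  · exact isOpen_set_pi Set.finite_univ fun _ _ => isOpen_Ioo
  · exact Set.univ_pi_nonempty_iff.2 fun _ => Set.nonempty_Ioo.2 (by positivity)

theorem setIntegral_unitBox_prod {n : ℕ} (f : Fin n → ℝ → ℝ) :
    ∫ y in unitBox n, ∏ j, f j (y j) = ∏ j, ∫ x in Set.Icc (0 : ℝ) 1, f j x := by
  rw [unitBox, volume_pi, Measure.restrict_pi_pi, integral_fintype_prod_eq_prod]

theorem setIntegral_unitBox_mul_prodDensity {n : ℕ} {p : Fin n → Polynomial ℝ}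
    (hp : ∀ j, ∫ x in Set.Icc (0 : ℝ) 1, (p j).eval x ^ 2 = 1) (h : ℝ → ℝ) (k : Fin n) :
    ∫ y in unitBox n, h (y k) * prodDensity p y =
      ∫ x in Set.Icc (0 : ℝ) 1, h x * (p k).eval x ^ 2 := by
  have h1 : ∀ y : Fin n → ℝ, h (y k) * prodDensity p y =
      ∏ j, (if j = k then h (y j) else 1) * (p j).eval (y j) ^ 2 := fun y => by
    rw [Finset.prod_mul_distrib, prodDensity]
    simp
  simp_rw [h1]
  rw [setIntegral_unitBox_prod (f := fun j x => (if j = k then h x else 1) * (p j).eval x ^ 2),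
    Finset.prod_eq_single k]
  · simp
  · intro j _ hj
    simp [hj, hp]
  · simp

theorem setIntegral_unitBox_prodDensity {n : ℕ} {p : Fin n → Polynomial ℝ}
    (hp : ∀ j, ∫ x in Set.Icc (0 : ℝ) 1, (p j).eval x ^ 2 = 1) :
    ∫ y in unitBox n, prodDensity p y = 1 := by
  simp only [prodDensity]
  rw [setIntegral_unitBox_prod (f := fun j x => (p j).eval x ^ 2)]
  simp [hp]

/-- A cube point outside the simplex has coordinate sum above 1, hence deviates from `a` by at least
1/(n+1) in that sum; Cauchy–Schwarz turns this into a lower bound for the squared distance. -/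
theorem one_le_of_notMem_cornerSimplex {n : ℕ} {a y : Fin n → ℝ}
    (ha : ∑ j, a j ≤ 1 - 1 / ((n : ℝ) + 1)) (hy : y ∈ unitBox n) (hyT : y ∉ cornerSimplex n) :
    1 ≤ (n : ℝ) * (n + 1) ^ 2 * ∑ k, (y k - a k) ^ 2 := by
  have h1 : 1 < ∑ j, y j := by
    by_contra! h
    exact hyT ⟨fun j => (hy j trivial).1, h⟩
  have h2 : 1 / ((n : ℝ) + 1) ≤ ∑ k, (y k - a k) := by
    rw [Finset.sum_sub_distrib]; linarith
  have h3 : (∑ k, (y k - a k)) ^ 2 ≤ n * ∑ k, (y k - a k) ^ 2 := by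
    simpa using sq_sum_le_card_mul_sum_sq (s := Finset.univ) (f := fun k => y k - a k)
  have h4 : (1 : ℝ) ≤ (n + 1) * ∑ k, (y k - a k) := by
    rw [div_le_iff₀ (by positivity)] at h2; linarith
  calc (1 : ℝ) ≤ ((n + 1) * ∑ k, (y k - a k)) ^ 2 := one_le_pow₀ h4
    _ = (n + 1) ^ 2 * (∑ k, (y k - a k)) ^ 2 := by ring
    _ ≤ (n + 1) ^ 2 * (n * ∑ k, (y k - a k) ^ 2) := by gcongr
    _ = _ := by ring

/-- Chebyshev's inequality: 1 - K ∑ (y_k - a_k)² is at most the indicator of the simplex on the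
cube, and its integral against the density factors into univariate second moments. -/
theorem half_le_setIntegral_cornerSimplex {n : ℕ} {a : Fin n → ℝ}
    (ha : ∑ j, a j ≤ 1 - 1 / ((n : ℝ) + 1)) {p : Fin n → Polynomial ℝ}
    (hp : ∀ j, ∫ x in Set.Icc (0 : ℝ) 1, (p j).eval x ^ 2 = 1) {ε : ℝ}
    (hε : ∀ j, ∫ x in Set.Icc (0 : ℝ) 1, (x - a j) ^ 2 * (p j).eval x ^ 2 ≤ ε)
    (hn : (n : ℝ) ^ 2 * (n + 1) ^ 2 * ε ≤ 1 / 2) :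
    1 / 2 ≤ ∫ y in cornerSimplex n, prodDensity p y := by
  have hc := continuous_prodDensity p
  have hint : ∀ {h : (Fin n → ℝ) → ℝ}, Continuous h → IntegrableOn h (unitBox n) :=
    fun hh => hh.continuousOn.integrableOn_compact (isCompact_unitBox n)
  set K : ℝ := (n : ℝ) * (n + 1) ^ 2 with hK
  have h1 : ∫ y in unitBox n, (prodDensity p y - ∑ k, K * ((y k - a k) ^ 2 * prodDensity p y)) ≤
      ∫ y in unitBox n, (cornerSimplex n).indicator (prodDensity p) y := by
    refine setIntegral_mono_on (hint (by fun_prop))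
      ((hint hc).indicator (isClosed_cornerSimplex n).measurableSet)
      (isCompact_unitBox n).measurableSet fun y hy => ?_
    have e : prodDensity p y - ∑ k, K * ((y k - a k) ^ 2 * prodDensity p y) =
        (1 - K * ∑ k, (y k - a k) ^ 2) * prodDensity p y := by
      rw [← Finset.mul_sum, ← Finset.sum_mul]; ring
    rw [e]
    by_cases hyT : y ∈ cornerSimplex n
    · rw [Set.indicator_of_mem hyT]
      refine mul_le_of_le_one_left (prodDensity_nonneg p y) ?_
      have : 0 ≤ K * ∑ k, (y k - a k) ^ 2 := by positivity
      linarith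
    · rw [Set.indicator_of_notMem hyT]
      have := one_le_of_notMem_cornerSimplex ha hy hyT
      exact mul_nonpos_of_nonpos_of_nonneg (by linarith) (prodDensity_nonneg p y)
  rw [setIntegral_indicator (isClosed_cornerSimplex n).measurableSet,
    Set.inter_eq_right.2 (cornerSimplex_subset_unitBox n),
    integral_sub (hint hc) (hint (by fun_prop)),
    setIntegral_unitBox_prodDensity hp,
    integral_finsetSum _ fun k _ => hint (by fun_prop)] at h1
  refine le_trans ?_ h1
  have h2 : ∑ k, ∫ y in unitBox n, K * ((y k - a k) ^ 2 * prodDensity p y) ≤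
      ∑ _k : Fin n, K * ε := by
    refine Finset.sum_le_sum fun k _ => ?_
    rw [integral_const_mul, setIntegral_unitBox_mul_prodDensity hp (fun x => (x - a k) ^ 2)]
    gcongr
    exact hε k
  have h3 : ∑ _k : Fin n, K * ε = (n : ℝ) ^ 2 * (n + 1) ^ 2 * ε := by simp [hK]; ring
  linarith

theorem setIntegral_cornerSimplex_le {n : ℕ} {p : Fin n → Polynomial ℝ}
    (hp : ∀ j, ∫ x in Set.Icc (0 : ℝ) 1, (p j).eval x ^ 2 = 1) {h : ℝ → ℝ} (hc : Continuous h)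
    (h0 : ∀ x ∈ Set.Icc (0 : ℝ) 1, 0 ≤ h x) (k : Fin n) :
    ∫ y in cornerSimplex n, h (y k) * prodDensity p y ≤
      ∫ x in Set.Icc (0 : ℝ) 1, h x * (p k).eval x ^ 2 := by
  rw [← setIntegral_unitBox_mul_prodDensity hp h k]
  have := continuous_prodDensity p
  refine setIntegral_mono_set ?_ ?_ (cornerSimplex_subset_unitBox n).eventuallyLE
  · exact (Continuous.continuousOn (by fun_prop)).integrableOn_compact (isCompact_unitBox n)
  · refine (ae_restrict_iff' (isCompact_unitBox n).measurableSet).2 (Filter.Eventually.of_forall ?_)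
    exact fun y hy => mul_nonneg (h0 _ (hy k trivial)) (prodDensity_nonneg p y)

theorem exists_prodDensity (n : ℕ) : ∃ C : ℝ, 0 ≤ C ∧ ∀ a ∈ cornerSimplex n,
    ∑ j, a j ≤ 1 - 1 / ((n : ℝ) + 1) → ∀ r : ℕ, 1 ≤ r → ∃ p : Fin n → Polynomial ℝ,
      ∑ j, (p j).natDegree ≤ r ∧ 0 < ∫ y in cornerSimplex n, prodDensity p y ∧
      ∀ k, ∫ y in cornerSimplex n, (y k - a k) ^ 2 * prodDensity p y ≤
          C / (r : ℝ) ^ 2 * ∫ y in cornerSimplex n, prodDensity p y ∧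
        (a k = 0 → ∫ y in cornerSimplex n, y k * prodDensity p y ≤
          C / (r : ℝ) ^ 2 * ∫ y in cornerSimplex n, prodDensity p y) := by
  refine ⟨2 ^ 18 * ((n : ℝ) + 1) ^ 6, by positivity, fun a ha ha' r hr => ?_⟩
  have hr' : (1 : ℝ) ≤ r := by exact_mod_cast hr
  have hn1 : (1 : ℝ) ≤ (n : ℝ) + 1 := by linarith [(Nat.cast_nonneg n : (0 : ℝ) ≤ n)]
  have hbox : ∀ j, a j ∈ Set.Icc (0 : ℝ) 1 := fun j => cornerSimplex_subset_unitBox n ha j trivial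
  -- For large `r`, n factors of degree 4N fit into `r`, and N ≥ 64(n+1)² makes the Chebyshev error
  -- at most 1/2. For smaller `r` the constant density suffices, since then C/r² ≥ 1.
  by_cases hlarge : 256 * (n + 1) ^ 3 ≤ r
  · set N := r / (4 * (n + 1)) with hNdef
    have hN1 : 64 * (n + 1) ^ 2 ≤ N := by
      rw [hNdef, Nat.le_div_iff_mul_le (by positivity)]
      refine le_trans (le_of_eq ?_) hlarge
      ring
    have hN64 : 64 ≤ N := le_trans (by nlinarith [Nat.zero_le n]) hN1
    -- Rounding down in the definition of `N` costs at most a factor 2.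
    have hNr : (r : ℝ) ≤ 8 * (n + 1) * N := by
      have h1 : r < 4 * (n + 1) * (N + 1) := by
        have := Nat.lt_mul_div_succ r (by positivity : 0 < 4 * (n + 1))
        exact this
      have h2 : r ≤ 8 * (n + 1) * N := by nlinarith
      exact_mod_cast h2
    have hN0 : (0 : ℝ) < N := by exact_mod_cast (by omega : 0 < N)
    choose p hd hp hp2 hp1 using fun j => exists_univariate_density hN64 (hbox j)
    have hhalf : 1 / 2 ≤ ∫ y in cornerSimplex n, prodDensity p y := by
      refine half_le_setIntegral_cornerSimplex ha' hp hp2 ?_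
      have hN1' : 64 * ((n : ℝ) + 1) ^ 2 ≤ N := by exact_mod_cast hN1
      rw [mul_div_assoc', div_le_iff₀ (by positivity)]
      calc (n : ℝ) ^ 2 * (n + 1) ^ 2 * 2048 ≤ (n + 1) ^ 2 * (n + 1) ^ 2 * 2048 := by
            gcongr; linarith
        _ = 1 / 2 * (64 * ((n : ℝ) + 1) ^ 2) ^ 2 := by ring
        _ ≤ 1 / 2 * (N : ℝ) ^ 2 := by gcongr
    have hfin : 2048 / (N : ℝ) ^ 2 ≤ 2 ^ 18 * ((n : ℝ) + 1) ^ 6 / (r : ℝ) ^ 2 *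
        ∫ y in cornerSimplex n, prodDensity p y := by
      calc 2048 / (N : ℝ) ^ 2 ≤ 2 ^ 18 * ((n : ℝ) + 1) ^ 6 / (r : ℝ) ^ 2 * (1 / 2) := by
            rw [div_mul_eq_mul_div, div_le_div_iff₀ (by positivity) (by positivity)]
            calc 2048 * (r : ℝ) ^ 2 ≤ 2048 * (8 * (n + 1) * N) ^ 2 := by gcongr
              _ = 2 ^ 18 * ((n : ℝ) + 1) ^ 2 * (1 / 2) * N ^ 2 := by ring
              _ ≤ _ := by
                gcongr 2 ^ 18 * ?_ * _ * _
                exact pow_le_pow_right₀ hn1 (by norm_num)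
        _ ≤ _ := by gcongr
    refine ⟨p, ?_, by linarith, fun k => ⟨?_, fun hk => ?_⟩⟩
    · calc ∑ j, (p j).natDegree ≤ ∑ _j : Fin n, 4 * N := Finset.sum_le_sum fun j _ => hd j
        _ = n * (4 * N) := by simp
        _ ≤ 4 * (n + 1) * N := by nlinarith
        _ ≤ r := Nat.mul_div_le _ _
    · exact (setIntegral_cornerSimplex_le hp (h := fun x => (x - a k) ^ 2) (by fun_prop)
        (fun x _ => sq_nonneg _) k).trans ((hp2 k).trans hfin)
    · exact (setIntegral_cornerSimplex_le hp (h := fun x => x) (by fun_prop)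
        (fun x hx => hx.1) k).trans ((hp1 k hk).trans hfin)
  · have hone : prodDensity (fun _ : Fin n => (1 : Polynomial ℝ)) = fun _ => 1 := by
      ext y; simp [prodDensity]
    have hfin : (1 : ℝ) ≤ 2 ^ 18 * ((n : ℝ) + 1) ^ 6 / (r : ℝ) ^ 2 := by
      have h1 : (r : ℝ) ≤ 256 * (n + 1) ^ 3 := by exact_mod_cast (not_le.1 hlarge).le
      rw [one_le_div (by positivity)]
      calc (r : ℝ) ^ 2 ≤ (256 * (n + 1) ^ 3) ^ 2 := by gcongr
        _ = 2 ^ 16 * ((n : ℝ) + 1) ^ 6 := by ring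
        _ ≤ _ := by gcongr <;> norm_num
    have hint : ∀ {h : (Fin n → ℝ) → ℝ}, Continuous h → IntegrableOn h (cornerSimplex n) :=
      fun hh => hh.continuousOn.integrableOn_compact (isCompact_cornerSimplex n)
    have hpos : 0 < ∫ y in cornerSimplex n, prodDensity (fun _ : Fin n => (1 : Polynomial ℝ)) y := by
      rw [hone]
      simpa [Measure.real] using ENNReal.toReal_pos (volume_cornerSimplex_pos n).ne'
        (isCompact_cornerSimplex n).measure_lt_top.ne
    have hle : ∀ h : (Fin n → ℝ) → ℝ, Continuous h → (∀ y ∈ cornerSimplex n, h y ≤ 1) →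
        ∫ y in cornerSimplex n, h y * prodDensity (fun _ : Fin n => (1 : Polynomial ℝ)) y ≤
          2 ^ 18 * ((n : ℝ) + 1) ^ 6 / (r : ℝ) ^ 2 *
            ∫ y in cornerSimplex n, prodDensity (fun _ : Fin n => (1 : Polynomial ℝ)) y := by
      intro h hc h1
      refine le_trans ?_ (le_mul_of_one_le_left hpos.le hfin)
      rw [hone]
      refine setIntegral_mono_on (hint (by fun_prop)) (hint (by fun_prop))
        (isClosed_cornerSimplex n).measurableSet fun y hy => ?_
      simpa using h1 y hy
    refine ⟨fun _ => 1, by simp, hpos, fun k => ⟨hle (fun y => (y k - a k) ^ 2) (by fun_prop) ?_,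
      fun _ => hle (fun y => y k) (by fun_prop) ?_⟩⟩
    · intro y hy
      have hy' := cornerSimplex_subset_unitBox n hy k trivial
      rw [sq_le_one_iff_abs_le_one, abs_le]
      exact ⟨by linarith [hy'.1, (hbox k).2], by linarith [hy'.2, (hbox k).1]⟩
    · exact fun y hy => (cornerSimplex_subset_unitBox n hy k trivial).2

/-! ### Taylor bound, first-order condition and reduction to a single square. -/

theorem contDiff_polyFun {n : ℕ} (f : MvPolynomial (Fin n) ℝ) : ContDiff ℝ 2 (polyFun f) := by
  have := AnalyticOnNhd.eval_continuousLinearMap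
    (EuclideanSpace.equiv (Fin n) ℝ : EuclideanSpace ℝ (Fin n) →L[ℝ] Fin n → ℝ) f
  exact contDiffOn_univ.1 (this.contDiffOn uniqueDiffOn_univ)

theorem sub_le_of_norm_fderiv_fderiv_le {E : Type*} [NormedAddCommGroup E] [NormedSpace ℝ E]
    {f : E → ℝ} (hf : ContDiff ℝ 2 f) {K : Set E} (hK : Convex ℝ K) {γ : ℝ}
    (hγ : ∀ x ∈ K, ‖fderiv ℝ (fderiv ℝ f) x‖ ≤ 2 * γ) {a x : E} (ha : a ∈ K) (hx : x ∈ K) :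
    f x - f a ≤ fderiv ℝ f a (x - a) + γ * ‖x - a‖ ^ 2 := by
  set u := x - a with hu
  have hd1 : Differentiable ℝ f := hf.differentiable (by norm_num)
  have hd2 : Differentiable ℝ (fderiv ℝ f) :=
    (hf.fderiv_right (m := 1) (by norm_num)).differentiable (by norm_num)
  -- The claim is φ(1) ≤ φ(0); φ decreases because the derivative of `f` is 2γ-Lipschitz along the
  -- segment.
  set φ : ℝ → ℝ := fun t => f (a + t • u) - t * fderiv ℝ f a u - γ * ‖u‖ ^ 2 * t ^ 2 with hφ
  have hder : ∀ t, HasDerivAt φ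
      (fderiv ℝ f (a + t • u) u - fderiv ℝ f a u - γ * ‖u‖ ^ 2 * (2 * t)) t := by
    intro t
    have h1 : HasDerivAt (fun t : ℝ => a + t • u) u t := by
      simpa using ((hasDerivAt_id t).smul_const u).const_add a
    have h2 := (hd1 (a + t • u)).hasFDerivAt.comp_hasDerivAt t h1
    have h3 : HasDerivAt (fun t : ℝ => t * fderiv ℝ f a u) (fderiv ℝ f a u) t := by
      simpa using (hasDerivAt_id t).mul_const (fderiv ℝ f a u)
    have h4 : HasDerivAt (fun t : ℝ => γ * ‖u‖ ^ 2 * t ^ 2) (γ * ‖u‖ ^ 2 * (2 * t)) t := by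
      simpa using (hasDerivAt_pow 2 t).const_mul (γ * ‖u‖ ^ 2)
    exact (h2.sub h3).sub h4
  have hanti : AntitoneOn φ (Set.Icc 0 1) := by
    refine antitoneOn_of_deriv_nonpos (convex_Icc 0 1)
      (fun t _ => (hder t).continuousAt.continuousWithinAt)
      (fun t _ => (hder t).differentiableAt.differentiableWithinAt) fun t ht => ?_
    rw [interior_Icc] at ht
    rw [(hder t).deriv]
    have hmem : a + t • u ∈ K := by
      have := hK.add_smul_sub_mem ha hx ⟨ht.1.le, ht.2.le⟩
      exact this
    have h5 := hK.norm_image_sub_le_of_norm_fderiv_le (fun y _ => hd2 y) hγ ha hmem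
    rw [add_sub_cancel_left, norm_smul, Real.norm_of_nonneg ht.1.le] at h5
    have h6 : fderiv ℝ f (a + t • u) u - fderiv ℝ f a u ≤ 2 * γ * (t * ‖u‖) * ‖u‖ := by
      rw [← _root_.sub_apply]
      refine (le_abs_self _).trans ?_
      refine ((fderiv ℝ f (a + t • u) - fderiv ℝ f a).le_opNorm u).trans ?_
      gcongr
    nlinarith
  have := hanti (Set.left_mem_Icc.2 zero_le_one) (Set.right_mem_Icc.2 zero_le_one) zero_le_one
  simp only [hφ, one_smul, zero_smul, add_zero, hu, add_sub_cancel] at this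
  linarith

theorem fderiv_apply_eq_zero_of_isMinOn {E : Type*} [NormedAddCommGroup E] [NormedSpace ℝ E]
    {f : E → ℝ} {a u : E} (hf : DifferentiableAt ℝ f a) {K : Set E} (hmin : IsMinOn f K a) {ε : ℝ}
    (hε : 0 < ε) (hu : ∀ t : ℝ, |t| < ε → a + t • u ∈ K) : fderiv ℝ f a u = 0 := by
  have h1 : HasDerivAt (fun t : ℝ => a + t • u) u 0 := by
    simpa using ((hasDerivAt_id (0 : ℝ)).smul_const u).const_add a
  have h2 : HasDerivAt (fun t : ℝ => f (a + t • u)) (fderiv ℝ f a u) 0 := by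
    refine HasFDerivAt.comp_hasDerivAt 0 ?_ h1
    simpa using hf.hasFDerivAt
  refine IsLocalMin.hasDerivAt_eq_zero ?_ h2
  filter_upwards [Metric.ball_mem_nhds (0 : ℝ) hε] with t ht
  rw [Metric.mem_ball, Real.dist_eq, sub_zero] at ht
  simpa using hmin (hu t ht)

theorem norm_fderiv_le_gradConst {n : ℕ} {K : Set (EuclideanSpace ℝ (Fin n))} (hK : IsCompact K)
    (f : MvPolynomial (Fin n) ℝ) {x : EuclideanSpace ℝ (Fin n)} (hx : x ∈ K) :
    ‖fderiv ℝ (polyFun f) x‖ ≤ gradConst K f := by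
  have e : ∀ x, ‖gradient (polyFun f) x‖ = ‖fderiv ℝ (polyFun f) x‖ := fun x => by
    simp [gradient]
  have hc : Continuous fun x => ‖gradient (polyFun f) x‖ := by
    simp_rw [e]
    exact ((contDiff_polyFun f).continuous_fderiv (by norm_num)).norm
  rw [← e]
  exact le_csSup (hK.bddAbove_image hc.continuousOn) (Set.mem_image_of_mem _ hx)

theorem norm_fderiv_fderiv_le_hessConst {n : ℕ} {K : Set (EuclideanSpace ℝ (Fin n))}
    (hK : IsCompact K) (f : MvPolynomial (Fin n) ℝ) {x : EuclideanSpace ℝ (Fin n)} (hx : x ∈ K) :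
    ‖fderiv ℝ (fderiv ℝ (polyFun f)) x‖ ≤ 2 * hessConst K f := by
  have hc : Continuous fun x => ‖fderiv ℝ (fderiv ℝ (polyFun f)) x‖ :=
    (((contDiff_polyFun f).fderiv_right (m := 1) (by norm_num)).continuous_fderiv
      (by norm_num)).norm
  have := le_csSup (hK.bddAbove_image hc.continuousOn) (Set.mem_image_of_mem _ hx)
  rw [hessConst]
  linarith

theorem polyFun_nonneg_of_isSumSq {n : ℕ} {q : MvPolynomial (Fin n) ℝ} (hq : IsSumSq q)
    (x : EuclideanSpace ℝ (Fin n)) : 0 ≤ polyFun q x := by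
  induction hq with
  | zero => simp [polyFun]
  | sq_add a _ ih =>
    simp only [polyFun, map_add, map_mul] at ih ⊢
    exact add_nonneg (mul_self_nonneg _) ih

theorem lasserreError_le_of_sq {n : ℕ} {K : Set (EuclideanSpace ℝ (Fin n))} (hK : IsCompact K)
    {f P : MvPolynomial (Fin n) ℝ} {a : EuclideanSpace ℝ (Fin n)} (ha : a ∈ K)
    (hmin : IsMinOn (polyFun f) K a) {r : ℕ} (hdeg : P.totalDegree ≤ r)
    (hpos : 0 < ∫ x in K, polyFun P x ^ 2) {ε : ℝ}
    (hε : ∫ x in K, (polyFun f x - polyFun f a) * polyFun P x ^ 2 ≤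
      ε * ∫ x in K, polyFun P x ^ 2) :
    lasserreError K volume f r ≤ ε := by
  have hcont : ∀ g : MvPolynomial (Fin n) ℝ, Continuous (polyFun g) := fun g =>
    (contDiff_polyFun g).continuous
  have hint : ∀ {h : EuclideanSpace ℝ (Fin n) → ℝ}, Continuous h → IntegrableOn h K :=
    fun hh => hh.continuousOn.integrableOn_compact hK
  have hpm : polyMin K f = polyFun f a := by
    refine IsLeast.csInf_eq ⟨Set.mem_image_of_mem _ ha, ?_⟩
    rintro _ ⟨x, hx, rfl⟩
    exact hmin hx
  set I := ∫ x in K, polyFun P x ^ 2 with hI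
  set q : MvPolynomial (Fin n) ℝ := (MvPolynomial.C (√I)⁻¹ * P) * (MvPolynomial.C (√I)⁻¹ * P)
  have hq : ∀ x, polyFun q x = polyFun P x ^ 2 / I := by
    intro x
    simp only [q, polyFun, map_mul, MvPolynomial.eval_C]
    have : (√I)⁻¹ * (√I)⁻¹ = I⁻¹ := by rw [← mul_inv, Real.mul_self_sqrt hpos.le]
    rw [div_eq_mul_inv, ← this]; ring
  have hqdeg : q.totalDegree ≤ 2 * r := by
    have : (MvPolynomial.C (√I)⁻¹ * P).totalDegree ≤ r :=
      (MvPolynomial.totalDegree_mul _ _).trans (by simpa using hdeg)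
    exact (MvPolynomial.totalDegree_mul _ _).trans (by omega)
  -- A real `sInf` is a lower bound only for sets bounded below; here `polyFun f a` bounds every
  -- admissible value.
  have hbdd : BddBelow {t : ℝ | ∃ q ∈ sosPolys n r,
      ∫ x in K, polyFun q x = 1 ∧ t = ∫ x in K, polyFun f x * polyFun q x} := by
    refine ⟨polyFun f a, ?_⟩
    rintro _ ⟨q, hq, h1, rfl⟩
    calc polyFun f a = ∫ x in K, polyFun f a * polyFun q x := by
          rw [integral_const_mul, h1, mul_one]
      _ ≤ _ := by
          refine setIntegral_mono_on (hint ((hcont q).const_mul _))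
            (hint ((hcont f).mul (hcont q))) hK.measurableSet fun x hx => ?_
          exact mul_le_mul_of_nonneg_right (hmin hx) (polyFun_nonneg_of_isSumSq hq.1 x)
  have hle := csInf_le hbdd ⟨q, ⟨IsSumSq.mul_self _, hqdeg⟩, by
    simp_rw [hq, integral_div]; exact div_self hpos.ne', rfl⟩
  rw [lasserreError, hpm, lasserreUpperBound]
  refine (sub_le_sub_right hle _).trans ?_
  simp_rw [hq, mul_div_assoc', integral_div]
  have hsplit : ∫ x in K, (polyFun f x - polyFun f a) * polyFun P x ^ 2 =
      (∫ x in K, polyFun f x * polyFun P x ^ 2) - polyFun f a * I := by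
    simp_rw [sub_mul]
    rw [integral_sub (hint (h := fun x => polyFun f x * polyFun P x ^ 2)
      ((hcont f).mul ((hcont P).pow 2))) (hint (h := fun x => polyFun f a * polyFun P x ^ 2)
      (((hcont P).pow 2).const_mul _)), integral_const_mul]
  rw [hsplit] at hε
  rw [sub_le_iff_le_add, div_le_iff₀ hpos]
  linarith

/-! ### Edge coordinates on a general simplex. -/

theorem totalDegree_aeval_le {σ : Type*} {l : MvPolynomial σ ℝ} (hl : l.totalDegree ≤ 1)
    (p : Polynomial ℝ) : (Polynomial.aeval l p).totalDegree ≤ p.natDegree := by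
  rw [Polynomial.aeval_eq_sum_range]
  refine MvPolynomial.totalDegree_finsetSum_le fun i hi => ?_
  refine (MvPolynomial.totalDegree_smul_le _ _).trans ((MvPolynomial.totalDegree_pow _ _).trans ?_)
  have := Finset.mem_range.1 hi
  nlinarith

/-- An affine change of variables scales Lebesgue integrals by a constant. -/
theorem exists_setIntegral_comp_affine {n : ℕ} (b : Module.Basis (Fin n) ℝ (EuclideanSpace ℝ (Fin n)))
    (v : EuclideanSpace ℝ (Fin n)) (T : Set (Fin n → ℝ)) : ∃ k : ℝ, 0 ≤ k ∧
      ∀ h : EuclideanSpace ℝ (Fin n) → ℝ,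
        k * ∫ x in {x | b.equivFun (x - v) ∈ T}, h x = ∫ y in T, h (v + b.equivFun.symm y) := by
  set L : (Fin n → ℝ) ≃L[ℝ] EuclideanSpace ℝ (Fin n) := b.equivFunL.symm with hL
  set Ψ : (Fin n → ℝ) ≃ₜ EuclideanSpace ℝ (Fin n) :=
    L.toHomeomorph.trans (Homeomorph.addLeft v) with hΨ
  have hΨe : ∀ y, Ψ y = v + b.equivFun.symm y := fun y => rfl
  -- Uniqueness of Haar measure gives the scalar, so no determinant is computed.
  have hmap : ∃ c : NNReal, Measure.map Ψ volume =
      c • (volume : Measure (EuclideanSpace ℝ (Fin n))) := by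
    refine ⟨Measure.addHaarScalarFactor (Measure.map L volume) volume, ?_⟩
    have h1 : Measure.map Ψ volume = Measure.map (fun x => v + x) (Measure.map L volume) := by
      rw [Measure.map_map (by fun_prop) L.continuous.measurable]
      rfl
    rw [h1, map_add_left_eq_self]
    exact Measure.isAddLeftInvariant_eq_smul _ _
  obtain ⟨c, hc⟩ := hmap
  refine ⟨c, c.2, fun h => ?_⟩
  have h2 := (Ψ.measurableEmbedding).setIntegral_map (μ := volume) h
    {x | b.equivFun (x - v) ∈ T}
  rw [hc, Measure.restrict_smul, integral_smul_nnreal_measure] at h2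
  have h3 : Ψ ⁻¹' {x | b.equivFun (x - v) ∈ T} = T := by
    ext y
    change b.equivFun (Ψ y - v) ∈ T ↔ y ∈ T
    rw [hΨe, add_sub_cancel_left, LinearEquiv.apply_symm_apply]
  rw [h3] at h2
  exact h2

/-- The basis formed by the edges of a full-dimensional simplex at the vertex `i`. -/
theorem exists_edgeBasis {n : ℕ} (s : Affine.Simplex ℝ (EuclideanSpace ℝ (Fin n)) n)
    (i : Fin (n + 1)) : ∃ b : Module.Basis (Fin n) ℝ (EuclideanSpace ℝ (Fin n)),
      ∀ j, b j = s.points (i.succAbove j) - s.points i := by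
  have h := (affineIndependent_iff_linearIndependent_vsub ℝ s.points i).1 s.independent
  have h2 := h.comp (fun j : Fin n => (⟨i.succAbove j, Fin.succAbove_ne i j⟩ : {x // x ≠ i}))
    fun j k hjk => by simpa using hjk
  refine ⟨basisOfLinearIndependentOfCardEqFinrank' _ h2 (by simp), fun j => ?_⟩
  simp

theorem exists_weights_of_mem_simplexSet {n : ℕ}
    {s : Affine.Simplex ℝ (EuclideanSpace ℝ (Fin n)) n} {x : EuclideanSpace ℝ (Fin n)}
    (hx : x ∈ simplexSet s) :
    ∃ w : Fin (n + 1) → ℝ, (∀ i, 0 ≤ w i) ∧ ∑ i, w i = 1 ∧ ∑ i, w i • s.points i = x := by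
  refine convexHull_min (t := {x | ∃ w : Fin (n + 1) → ℝ, (∀ i, 0 ≤ w i) ∧ ∑ i, w i = 1 ∧
    ∑ i, w i • s.points i = x}) ?_ ?_ hx
  · rintro _ ⟨i, rfl⟩
    refine ⟨fun j => if j = i then 1 else 0, fun j => ?_, by simp, by simp⟩
    beta_reduce
    split_ifs <;> norm_num
  · rintro _ ⟨w, hw, hw1, rfl⟩ _ ⟨w', hw', hw1', rfl⟩ α β hα hβ hαβ
    refine ⟨fun i => α * w i + β * w' i, fun i => ?_, ?_, ?_⟩
    · have := hw i
      have := hw' i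
      positivity
    · rw [Finset.sum_add_distrib, ← Finset.mul_sum, ← Finset.mul_sum, hw1, hw1']
      linarith
    · simp only [add_smul, mul_smul, Finset.sum_add_distrib, Finset.smul_sum]

theorem equivFun_sum_sub {n : ℕ} {s : Affine.Simplex ℝ (EuclideanSpace ℝ (Fin n)) n}
    {i : Fin (n + 1)} {b : Module.Basis (Fin n) ℝ (EuclideanSpace ℝ (Fin n))}
    (hb : ∀ j, b j = s.points (i.succAbove j) - s.points i) {w : Fin (n + 1) → ℝ}
    (hw : ∑ k, w k = 1) :
    b.equivFun (∑ k, w k • s.points k - s.points i) = fun j => w (i.succAbove j) := by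
  rw [← LinearEquiv.eq_symm_apply, Module.Basis.equivFun_symm_apply]
  simp_rw [hb, smul_sub]
  rw [Fin.sum_univ_succAbove _ i] at hw
  rw [Fin.sum_univ_succAbove _ i, Finset.sum_sub_distrib, ← Finset.sum_smul,
    eq_sub_iff_add_eq'.2 hw, sub_smul, one_smul]
  abel

/-- The edge coordinates at vertex `i` are the barycentric weights of the other vertices; the weight
of `i` is recovered as 1 - ∑ y. -/
theorem simplexSet_eq {n : ℕ} {s : Affine.Simplex ℝ (EuclideanSpace ℝ (Fin n)) n}
    {i : Fin (n + 1)} {b : Module.Basis (Fin n) ℝ (EuclideanSpace ℝ (Fin n))}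
    (hb : ∀ j, b j = s.points (i.succAbove j) - s.points i) :
    simplexSet s = {x | b.equivFun (x - s.points i) ∈ cornerSimplex n} := by
  ext x
  constructor
  · intro hx
    obtain ⟨w, hw, hw1, rfl⟩ := exists_weights_of_mem_simplexSet hx
    change b.equivFun (_ - _) ∈ cornerSimplex n
    rw [equivFun_sum_sub hb hw1]
    refine ⟨fun j => hw _, ?_⟩
    rw [Fin.sum_univ_succAbove _ i] at hw1
    linarith [hw i]
  · intro hx
    change b.equivFun (x - s.points i) ∈ cornerSimplex n at hx
    set y := b.equivFun (x - s.points i) with hy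
    have hsum : ∑ k, i.insertNth (α := fun _ => ℝ) (1 - ∑ j, y j) y k = 1 := by
      rw [Fin.sum_univ_succAbove _ i]
      simp
    refine mem_convexHull_of_exists_fintype (i.insertNth (α := fun _ => ℝ) (1 - ∑ j, y j) y)
      s.points ?_ hsum (fun k => Set.mem_range_self k) ?_
    · intro k
      rcases Fin.eq_self_or_eq_succAbove i k with rfl | ⟨j, rfl⟩
      · simpa using hx.2
      · simpa using hx.1 j
    · have := equivFun_sum_sub hb hsum
      simp only [Fin.insertNth_apply_succAbove] at this
      exact sub_left_injective (b.equivFun.injective (this.trans hy))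

/-- Pigeonhole: n + 1 weights sum to 1, so one is at least 1/(n+1). -/
theorem exists_vertex_sum_le {n : ℕ} {s : Affine.Simplex ℝ (EuclideanSpace ℝ (Fin n)) n}
    {a : EuclideanSpace ℝ (Fin n)} (ha : a ∈ simplexSet s) :
    ∃ i : Fin (n + 1), ∀ b : Module.Basis (Fin n) ℝ (EuclideanSpace ℝ (Fin n)),
      (∀ j, b j = s.points (i.succAbove j) - s.points i) →
      ∑ j, b.equivFun (a - s.points i) j ≤ 1 - 1 / ((n : ℝ) + 1) := by
  obtain ⟨w, hw, hw1, rfl⟩ := exists_weights_of_mem_simplexSet ha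
  obtain ⟨i, -, hi⟩ := Finset.exists_le_of_sum_le (s := Finset.univ)
    (f := fun _ : Fin (n + 1) => 1 / ((n : ℝ) + 1)) (g := w) Finset.univ_nonempty (by
      rw [hw1]
      simp
      rw [mul_inv_cancel₀ (by positivity)])
  refine ⟨i, fun b hb => ?_⟩
  rw [equivFun_sum_sub hb hw1]
  rw [Fin.sum_univ_succAbove _ i] at hw1
  linarith

theorem exists_coordinate_polynomial {n : ℕ}
    (b : Module.Basis (Fin n) ℝ (EuclideanSpace ℝ (Fin n))) (v : EuclideanSpace ℝ (Fin n))
    (j : Fin n) : ∃ l : MvPolynomial (Fin n) ℝ, l.totalDegree ≤ 1 ∧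
      ∀ x, polyFun l x = b.equivFun (x - v) j := by
  refine ⟨∑ k, b.coord j (EuclideanSpace.single k 1) • MvPolynomial.X k -
    MvPolynomial.C (b.coord j v), ?_, fun x => ?_⟩
  · refine (MvPolynomial.totalDegree_sub _ _).trans (max_le ?_ (by simp))
    exact MvPolynomial.totalDegree_finsetSum_le fun k _ =>
      (MvPolynomial.totalDegree_smul_le _ _).trans (MvPolynomial.totalDegree_X k).le
  · have hx : x = ∑ k, x k • EuclideanSpace.single k (1 : ℝ) := by
      ext i
      simp [Pi.single_apply]
    have : b.coord j x = ∑ k, x k * b.coord j (EuclideanSpace.single k 1) := by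
      conv_lhs => rw [hx, map_sum]
      simp only [map_smul, smul_eq_mul]
    rw [Module.Basis.equivFun_apply, ← Module.Basis.coord_apply, map_sub, this]
    simp [polyFun, MvPolynomial.smul_eval, mul_comm]

theorem exists_polynomial_prodDensity {n : ℕ}
    (b : Module.Basis (Fin n) ℝ (EuclideanSpace ℝ (Fin n))) (v : EuclideanSpace ℝ (Fin n))
    (p : Fin n → Polynomial ℝ) : ∃ P : MvPolynomial (Fin n) ℝ,
      P.totalDegree ≤ ∑ j, (p j).natDegree ∧
      ∀ x, polyFun P x ^ 2 = prodDensity p (b.equivFun (x - v)) := by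
  choose l hl hle using exists_coordinate_polynomial b v
  refine ⟨∏ j, Polynomial.aeval (l j) (p j), ?_, fun x => ?_⟩
  · exact (MvPolynomial.totalDegree_finsetProd _ _).trans
      (Finset.sum_le_sum fun j _ => totalDegree_aeval_le (hl j) (p j))
  · rw [prodDensity, Finset.prod_pow]
    congr 1
    rw [polyFun, map_prod]
    refine Finset.prod_congr rfl fun j _ => ?_
    rw [← hle, Polynomial.aeval_def, Polynomial.hom_eval₂, polyFun, Polynomial.eval,
      MvPolynomial.algebraMap_eq]
    congr 1
    ext c
    simp

theorem sum_smul_basis {n : ℕ} (b : Module.Basis (Fin n) ℝ (EuclideanSpace ℝ (Fin n)))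
    (v a x : EuclideanSpace ℝ (Fin n)) :
    x - a = ∑ j, (b.equivFun (x - v) j - b.equivFun (a - v) j) • b j := by
  simp_rw [← Pi.sub_apply, ← map_sub, sub_sub_sub_cancel_right]
  exact (b.sum_equivFun _).symm

theorem norm_sub_sq_le_of_coordinates {n : ℕ}
    (b : Module.Basis (Fin n) ℝ (EuclideanSpace ℝ (Fin n))) {D : ℝ} (hD : ∀ j, ‖b j‖ ≤ D)
    (v a x : EuclideanSpace ℝ (Fin n)) :
    ‖x - a‖ ^ 2 ≤ D ^ 2 * n * ∑ j, (b.equivFun (x - v) j - b.equivFun (a - v) j) ^ 2 := by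
  have h1 : ‖x - a‖ ≤ ∑ j, |b.equivFun (x - v) j - b.equivFun (a - v) j| * D := by
    rw [sum_smul_basis b v a x]
    refine (norm_sum_le _ _).trans (Finset.sum_le_sum fun j _ => ?_)
    rw [norm_smul, Real.norm_eq_abs]
    gcongr
    exact hD j
  rw [← Finset.sum_mul] at h1
  calc ‖x - a‖ ^ 2 ≤ ((∑ j, |b.equivFun (x - v) j - b.equivFun (a - v) j|) * D) ^ 2 := by gcongr
    _ = D ^ 2 * (∑ j, |b.equivFun (x - v) j - b.equivFun (a - v) j|) ^ 2 := by ring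
    _ ≤ D ^ 2 * (n * ∑ j, |b.equivFun (x - v) j - b.equivFun (a - v) j| ^ 2) := by
        gcongr
        simpa using sq_sum_le_card_mul_sum_sq (s := Finset.univ)
          (f := fun j => |b.equivFun (x - v) j - b.equivFun (a - v) j|)
    _ = _ := by simp_rw [sq_abs]; ring

/-! ### Local bound at the minimiser and conclusion. -/

theorem isCompact_simplexSet {n : ℕ} (s : Affine.Simplex ℝ (EuclideanSpace ℝ (Fin n)) n) :
    IsCompact (simplexSet s) :=
  (Set.finite_range s.points).isCompact_convexHull ℝ

/-- Moving a point along an edge at a vertex with positive weight stays inside the simplex. -/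
theorem exists_edge_segment_subset {n : ℕ} {s : Affine.Simplex ℝ (EuclideanSpace ℝ (Fin n)) n}
    {i : Fin (n + 1)} {b : Module.Basis (Fin n) ℝ (EuclideanSpace ℝ (Fin n))}
    (hb : ∀ j, b j = s.points (i.succAbove j) - s.points i) {a : EuclideanSpace ℝ (Fin n)}
    (ha : a ∈ simplexSet s) (hsum : ∑ j, b.equivFun (a - s.points i) j < 1) {j : Fin n}
    (hj : b.equivFun (a - s.points i) j ≠ 0) :
    ∃ ε : ℝ, 0 < ε ∧ ∀ t : ℝ, |t| < ε → a + t • b j ∈ simplexSet s := by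
  rw [simplexSet_eq hb] at ha ⊢
  change b.equivFun (a - s.points i) ∈ cornerSimplex n at ha
  set y := b.equivFun (a - s.points i) with hy
  have hyj : 0 < y j := lt_of_le_of_ne (ha.1 j) hj.symm
  refine ⟨min (y j) (1 - ∑ k, y k), lt_min hyj (by linarith), fun t ht => ?_⟩
  have ht1 := abs_lt.1 (ht.trans_le (min_le_left _ _))
  have ht2 := abs_lt.1 (ht.trans_le (min_le_right _ _))
  change b.equivFun (a + t • b j - s.points i) ∈ cornerSimplex n
  rw [add_sub_right_comm, map_add, map_smul, ← hy]
  have hbj : ∀ k, b.equivFun (b j) k = if j = k then 1 else 0 := b.equivFun_self j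
  refine ⟨fun k => ?_, ?_⟩
  · by_cases hk : k = j
    · rw [hk, Pi.add_apply, Pi.smul_apply, hbj, if_pos rfl, smul_eq_mul]
      linarith
    · have := ha.1 k
      rwa [Pi.add_apply, Pi.smul_apply, hbj, if_neg (Ne.symm hk), smul_zero, add_zero]
  · simp only [Pi.add_apply, Pi.smul_apply, hbj, smul_eq_mul, mul_ite, mul_one, mul_zero,
      Finset.sum_add_distrib, Finset.sum_ite_eq, Finset.mem_univ, if_true]
    linarith

/-- Expand the linear Taylor term along the edges: it vanishes on edges with positive coordinate,
where `a` is interior to a feasible segment, and elsewhere is at most the gradient bound times the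
edge length. -/
theorem polyFun_sub_le {n : ℕ} {s : Affine.Simplex ℝ (EuclideanSpace ℝ (Fin n)) n}
    {i : Fin (n + 1)} {b : Module.Basis (Fin n) ℝ (EuclideanSpace ℝ (Fin n))}
    (hb : ∀ j, b j = s.points (i.succAbove j) - s.points i) {D : ℝ}
    (hD : ∀ j, ‖b j‖ ≤ D)
    {f : MvPolynomial (Fin n) ℝ} {a : EuclideanSpace ℝ (Fin n)} (ha : a ∈ simplexSet s)
    (hmin : IsMinOn (polyFun f) (simplexSet s) a)
    (hsum : ∑ j, b.equivFun (a - s.points i) j < 1) {x : EuclideanSpace ℝ (Fin n)}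
    (hx : x ∈ simplexSet s) :
    polyFun f x - polyFun f a ≤
      ∑ j, (|gradConst (simplexSet s) f| * D *
          (if b.equivFun (a - s.points i) j = 0 then b.equivFun (x - s.points i) j else 0) +
        |hessConst (simplexSet s) f| * D ^ 2 * n *
          (b.equivFun (x - s.points i) j - b.equivFun (a - s.points i) j) ^ 2) := by
  have hK := isCompact_simplexSet s
  have htaylor := sub_le_of_norm_fderiv_fderiv_le (contDiff_polyFun f)
    (convex_convexHull ℝ (Set.range s.points))
    (fun x hx => norm_fderiv_fderiv_le_hessConst hK f hx) ha hx
  have hxT := hx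
  rw [simplexSet_eq hb] at hxT
  refine htaylor.trans ?_
  rw [Finset.sum_add_distrib]
  refine add_le_add ?_ ?_
  · rw [sum_smul_basis b (s.points i) a x, map_sum]
    refine Finset.sum_le_sum fun j _ => ?_
    rw [map_smul, smul_eq_mul]
    split_ifs with h
    · rw [h, sub_zero, mul_comm]
      refine mul_le_mul_of_nonneg_right ?_ (hxT.1 j)
      refine (le_abs_self _).trans (((fderiv ℝ (polyFun f) a).le_opNorm (b j)).trans ?_)
      have := (norm_fderiv_le_gradConst hK f ha).trans (le_abs_self _)
      gcongr
      exact hD j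
    · obtain ⟨ε, hε, hseg⟩ := exists_edge_segment_subset hb ha hsum h
      rw [fderiv_apply_eq_zero_of_isMinOn
        ((contDiff_polyFun f).differentiable (by norm_num) a) hmin hε hseg]
      simp
  · rw [← Finset.mul_sum]
    calc _ ≤ |hessConst (simplexSet s) f| * ‖x - a‖ ^ 2 := by gcongr; exact le_abs_self _
      _ ≤ |hessConst (simplexSet s) f| * (D ^ 2 * n *
          ∑ j, (b.equivFun (x - s.points i) j - b.equivFun (a - s.points i) j) ^ 2) := by
          gcongr
          exact norm_sub_sq_le_of_coordinates b hD _ _ _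
      _ = _ := by ring

theorem setIntegral_cornerSimplex_sum_le {n : ℕ} {a : Fin n → ℝ} {p : Fin n → Polynomial ℝ}
    {δ A B : ℝ} (hA : 0 ≤ A) (hB : 0 ≤ B)
    (h2 : ∀ k, ∫ y in cornerSimplex n, (y k - a k) ^ 2 * prodDensity p y ≤ δ)
    (h1 : ∀ k, a k = 0 → ∫ y in cornerSimplex n, y k * prodDensity p y ≤ δ) (hδ : 0 ≤ δ) :
    ∫ y in cornerSimplex n, (∑ j, (A * (if a j = 0 then y j else 0) + B * (y j - a j) ^ 2)) *
      prodDensity p y ≤ n * (A + B) * δ := by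
  have hc := continuous_prodDensity p
  have hint : ∀ {h : (Fin n → ℝ) → ℝ}, Continuous h → IntegrableOn h (cornerSimplex n) :=
    fun hh => hh.continuousOn.integrableOn_compact (isCompact_cornerSimplex n)
  have hif : ∀ j, Continuous fun y : Fin n → ℝ => if a j = 0 then y j else 0 := fun j => by
    split_ifs <;> fun_prop
  have e : ∀ y, (∑ j, (A * (if a j = 0 then y j else 0) + B * (y j - a j) ^ 2)) *
      prodDensity p y = ∑ j, (A * ((if a j = 0 then y j else 0) * prodDensity p y) +
        B * ((y j - a j) ^ 2 * prodDensity p y)) := fun y => by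
    rw [Finset.sum_mul]
    exact Finset.sum_congr rfl fun j _ => by ring
  simp_rw [e]
  rw [integral_finsetSum _ fun j _ => hint (by have := hif j; fun_prop)]
  calc _ ≤ ∑ _j : Fin n, (A + B) * δ := Finset.sum_le_sum fun j _ => by
        rw [integral_add (hint (by have := hif j; fun_prop)) (hint (by fun_prop)),
          integral_const_mul, integral_const_mul, add_mul]
        gcongr
        · by_cases h : a j = 0
          · simpa only [h, if_true] using h1 j h
          · simpa [h] using hδ
        · exact h2 j
    _ = n * (A + B) * δ := by simp; ring

theorem mainTheorem6 (n : ℕ) (s : Affine.Simplex ℝ (EuclideanSpace ℝ (Fin n)) n) :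
    ∃ c : ℝ → ℝ → ℝ, (∀ β γ : ℝ, 0 < c β γ) ∧
      ∀ (f : MvPolynomial (Fin n) ℝ) (r : ℕ), 1 ≤ r →
        lasserreError (simplexSet s) volume f r ≤
          c (gradConst (simplexSet s) f) (hessConst (simplexSet s) f) / (r : ℝ) ^ 2 := by
  obtain ⟨C, hC, hprod⟩ := exists_prodDensity n
  -- Summing over all pairs of vertices makes `D` independent of the chosen vertex, which varies
  -- with `f`.
  set D : ℝ := ∑ k, ∑ i, ‖s.points k - s.points i‖ with hDdef
  have hD0 : 0 ≤ D := by positivity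
  have hD : ∀ k i, ‖s.points k - s.points i‖ ≤ D := fun k i =>
    (Finset.single_le_sum (f := fun i => ‖s.points k - s.points i‖)
      (fun _ _ => norm_nonneg _) (Finset.mem_univ i)).trans
    (Finset.single_le_sum (f := fun k => ∑ i, ‖s.points k - s.points i‖)
      (fun _ _ => by positivity) (Finset.mem_univ k))
  -- The absolute values and the + 1 keep the constant positive for all real arguments.
  refine ⟨fun β γ => n * (|β| * D + |γ| * D ^ 2 * n) * C + 1, fun β γ => by positivity,
    fun f r hr => ?_⟩
  have hr' : (0 : ℝ) < r := by exact_mod_cast hr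
  have hK := isCompact_simplexSet s
  obtain ⟨a, ha, hmin⟩ := hK.exists_isMinOn ⟨s.points 0, subset_convexHull ℝ _ ⟨0, rfl⟩⟩
    (contDiff_polyFun f).continuous.continuousOn
  obtain ⟨i, hi⟩ := exists_vertex_sum_le ha
  obtain ⟨b, hb⟩ := exists_edgeBasis s i
  have hsum := hi b hb
  have haT := ha
  rw [simplexSet_eq hb] at haT
  obtain ⟨p, hdeg, hpos, hp⟩ := hprod _ haT hsum r hr
  obtain ⟨P, hPdeg, hP⟩ := exists_polynomial_prodDensity b (s.points i) p
  obtain ⟨k, hk, hchange⟩ := exists_setIntegral_comp_affine b (s.points i) (cornerSimplex n)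
  rw [← simplexSet_eq hb] at hchange
  have hback : ∀ y, b.equivFun (s.points i + b.equivFun.symm y - s.points i) = y := fun y => by
    rw [add_sub_cancel_left, LinearEquiv.apply_symm_apply]
  have hmass : k * ∫ x in simplexSet s, polyFun P x ^ 2 =
      ∫ y in cornerSimplex n, prodDensity p y := by
    rw [hchange]
    simp_rw [hP, hback]
  have hkpos : 0 < k * ∫ x in simplexSet s, polyFun P x ^ 2 := hmass ▸ hpos
  -- Nonvanishing of the Jacobian factor is read off from the positive mass of the density.
  have hk0 : 0 < k := lt_of_le_of_ne hk fun h => by simp [← h] at hkpos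
  set A := |gradConst (simplexSet s) f| * D
  set B := |hessConst (simplexSet s) f| * D ^ 2 * n
  have hA : 0 ≤ A := by positivity
  have hB : 0 ≤ B := by positivity
  refine le_trans (lasserreError_le_of_sq hK ha hmin (hPdeg.trans hdeg)
    (pos_of_mul_pos_right hkpos hk) (ε := n * (A + B) * C / (r : ℝ) ^ 2) ?_) ?_
  · refine le_of_mul_le_mul_left ?_ hk0
    rw [mul_left_comm, hmass, hchange]
    simp_rw [hP, hback]
    have hbound := setIntegral_cornerSimplex_sum_le hA hB (fun k => (hp k).1)
      (fun k hk => (hp k).2 hk) (by positivity)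
    refine le_trans ?_ (hbound.trans_eq (by ring))
    have hc := continuous_prodDensity p
    have hcf := (contDiff_polyFun f).continuous
    have hcb : Continuous fun y => b.equivFun.symm y := b.equivFunL.symm.continuous
    refine setIntegral_mono_on
      ((Continuous.continuousOn (by fun_prop)).integrableOn_compact (isCompact_cornerSimplex n))
      ((Continuous.continuousOn ?_).integrableOn_compact (isCompact_cornerSimplex n))
      (isClosed_cornerSimplex n).measurableSet fun y hy => ?_
    · refine Continuous.mul (continuous_finsetSum _ fun j _ => ?_) hc
      split_ifs <;> fun_prop
    · refine mul_le_mul_of_nonneg_right ?_ (prodDensity_nonneg p y)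
      have hlt : ∑ j, b.equivFun (a - s.points i) j < 1 :=
        hsum.trans_lt (sub_lt_self _ (by positivity))
      have := polyFun_sub_le hb (fun j => by rw [hb]; exact hD _ _) ha hmin hlt
        (x := s.points i + b.equivFun.symm y) (by
          rw [simplexSet_eq hb]
          change b.equivFun (s.points i + b.equivFun.symm y - s.points i) ∈ cornerSimplex n
          rwa [hback])
      rwa [hback] at this
  · gcongr
    simp only [A, B]
    linarith
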